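/- Let $f$ be a homeomorphism of a compact metric space $(X,d)$ and let $n$ be a natural number. Suppose that: 1. $f$ is positively $n$-expansive: there is $c>0$ such that for every $x\in X$ the set $\{y\in X:\ d(f^k(y),f^k(x))\le c \text{ for all } k\ge 0\}$ has at most $n$ elements; 2. $f$ has the shadowing property: for every $\varepsilon>0$ there is $\delta>0$ such that for every sequence $(x_k)_{k\in\mathbb Z}$ in $X$ with $d(f(x_k),x_{k+1})<\delta$ for all $k\in\mathbb Z$ (a $\delta$-pseudo-orbit) there is $y\in X$ with $d(f^k(y),x_k)<\varepsilon$ for all $k\in\mathbb Z$; 3. $f$ has only finitely many chain recurrent classes. Here $p\in X$ is chain recurrent if for every $\varepsilon>0$ there are $l\ge 1$ and $x_0,\dots,x_l\in X$ with $x_0=x_l=p$ and $d(f(x_k),x_{k+1})<\varepsilon$ for $0\le k<l$; and the chain recurrent class of a chain recurrent point $p$ is the set of all $q\in X$ such that for every $\varepsilon>0$ there is a periodic $\varepsilon$-pseudo-orbit $(x_k)_{k\in\mathbb Z}$ containing both $p$ and $q$. Then $X$ is finite. -/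

import Mathlib

namespace NExpansive

variable {X : Type*} [MetricSpace X]

/-- The local stable set `W^s_c(x)` of `x` of size `c`. -/
def localStableSet (f : X → X) (c : ℝ) (x : X) : Set X :=
  {y | ∀ k : ℕ, dist (f^[k] y) (f^[k] x) ≤ c}

/-- `f` is positively `n`-expansive: for some `c > 0`, every local stable set of size `c` has at
most `n` points. -/
def PositivelyNExpansive (n : ℕ) (f : X → X) : Prop :=
  ∃ c : ℝ, 0 < c ∧ ∀ x : X, (localStableSet f c x).encard ≤ n

/-- `(x_k)_{k ∈ I}` is an `ε`-pseudo-orbit of `f`. Only the values of `x` on `I` matter. It is used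
for nonempty sets `I` of consecutive integers. -/
def IsPseudoOrbit (f : X → X) (ε : ℝ) (I : Set ℤ) (x : ℤ → X) : Prop :=
  ∀ k : ℤ, k ∈ I → k + 1 ∈ I → dist (f (x k)) (x (k + 1)) < ε

/-- The two-sided sequence `x` is `ε`-shadowed by (the full orbit of) some point. -/
def IsShadowed (f : X ≃ₜ X) (ε : ℝ) (x : ℤ → X) : Prop :=
  ∃ y : X, ∀ k : ℤ, dist ((f ^ k) y) (x k) < ε

/-- The (standard, two-sided) shadowing property. -/
def ShadowingProperty (f : X ≃ₜ X) : Prop :=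
  ∀ ε : ℝ, 0 < ε → ∃ δ : ℝ, 0 < δ ∧
    ∀ x : ℤ → X, IsPseudoOrbit f δ Set.univ x → IsShadowed f ε x

/-- The chain recurrent set `CR(f)`: for each `ε > 0` there is a non-trivial finite
`ε`-pseudo-orbit starting and ending at `p`. -/
def chainRecurrentSet (f : X → X) : Set X :=
  {p | ∀ ε : ℝ, 0 < ε → ∃ (l : ℕ) (x : ℤ → X), 0 < l ∧
    IsPseudoOrbit f ε (Set.Icc 0 (l : ℤ)) x ∧ x 0 = p ∧ x l = p}

/-- The chain recurrent class of `p`: all `q` such that for every `ε > 0` there is a periodic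
`ε`-pseudo-orbit containing both `p` and `q`. -/
def chainRecurrentClass (f : X → X) (p : X) : Set X :=
  {q | ∀ ε : ℝ, 0 < ε → ∃ (l : ℕ) (x : ℤ → X), 0 < l ∧ Function.Periodic x (l : ℤ) ∧
    IsPseudoOrbit f ε Set.univ x ∧ p ∈ Set.range x ∧ q ∈ Set.range x}

/-- The collection of all chain recurrent classes of `f`, as a set of subsets of `X`. -/
def chainRecurrentClasses (f : X → X) : Set (Set X) :=
  chainRecurrentClass f '' chainRecurrentSet f

end NExpansive

namespace NExpansive

open Filter Topology

/-! Each chain recurrent class is finite. Suppose chains of equal length lead from far-apart points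
`a`, `b` to `p`, and both points are reachable from `p`. Two loops at `p` of equal length then visit
`a` and `b` at the same time. Use one loop in a single block and the other in all remaining blocks:
moving that block through the past gives infinitely many distinct shadowing points with a common
future, against `n`-expansiveness (`dist_lt_of_hasChain`). So backward iterates are equicontinuous
on a class, hence by compactness forward iterates are too, and small balls of the class lie in
finite local stable sets.

With finitely many classes the chain recurrent set is finite. Every orbit ends up in finitely many
local stable sets, so it repeats a point; by injectivity it is periodic, hence chain recurrent. -/

/-- There is a `δ`-pseudo-orbit of length `l` from `p` to `q`. -/
def HasChain {X : Type*} [MetricSpace X] (f : X → X) (δ : ℝ) (l : ℕ) (p q : X) : Prop :=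
  ∃ u : ℕ → X, u 0 = p ∧ u l = q ∧ ∀ k < l, dist (f (u k)) (u (k + 1)) < δ

/-- For every `δ > 0` there is a nontrivial `δ`-pseudo-orbit from `p` to `q`. -/
def ChainReach {X : Type*} [MetricSpace X] (f : X → X) (p q : X) : Prop :=
  ∀ δ : ℝ, 0 < δ → ∃ l : ℕ, 0 < l ∧ HasChain f δ l p q

/-! ### Calculus of finite chains and chain recurrence -/

section Chains

variable {X : Type*} [MetricSpace X] {f : X → X} {δ : ℝ} {l m : ℕ} {p q r : X}

theorem HasChain.concat (h : HasChain f δ l p q) (h' : HasChain f δ m q r) :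
    ∃ u : ℕ → X, u 0 = p ∧ u l = q ∧ u (l + m) = r ∧
      ∀ k < l + m, dist (f (u k)) (u (k + 1)) < δ := by
  obtain ⟨a, rfl, ha, ha'⟩ := h
  obtain ⟨b, hb, rfl, hb'⟩ := h'
  refine ⟨fun k => if k ≤ l then a k else b (k - l), by simp, by simp [ha], ?_, ?_⟩
  · rcases Nat.eq_zero_or_pos m with rfl | hm
    · simp [ha, hb]
    · have : ¬ l + m ≤ l := by omega
      simp only [this, if_false]
      congr 1
      omega
  · intro k hk
    rcases lt_trichotomy k l with h | h | h
    · have h1 : k ≤ l := h.le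
      have h2 : k + 1 ≤ l := h
      simpa only [h1, h2, if_true] using ha' k h
    · subst h
      have h2 : ¬ k + 1 ≤ k := by omega
      have := hb' 0 (by omega)
      simp only [le_refl, h2, if_true, if_false, ha, ← hb]
      simpa using this
    · have h1 : ¬ k ≤ l := by omega
      have h2 : ¬ k + 1 ≤ l := by omega
      have := hb' (k - l) (by omega)
      simp only [h1, h2, if_false]
      rwa [show k + 1 - l = k - l + 1 by omega]

theorem HasChain.trans (h : HasChain f δ l p q) (h' : HasChain f δ m q r) :
    HasChain f δ (l + m) p r := by
  obtain ⟨u, h0, -, h1, h2⟩ := h.concat h'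
  exact ⟨u, h0, h1, h2⟩

theorem HasChain.single (h : dist (f p) q < δ) : HasChain f δ 1 p q := by
  refine ⟨fun k => if k = 0 then p else q, by simp, by simp, ?_⟩
  intro k hk
  obtain rfl : k = 0 := by omega
  simpa using h

theorem HasChain.iterate (hδ : 0 < δ) (p : X) (k : ℕ) : HasChain f δ k p (f^[k] p) := by
  refine ⟨fun j => f^[j] p, rfl, rfl, fun j _ => ?_⟩
  simp only [Function.iterate_succ_apply', dist_self, hδ]

theorem HasChain.mono {δ' : ℝ} (h : HasChain f δ l p q) (hδ : δ ≤ δ') : HasChain f δ' l p q := by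
  obtain ⟨u, h0, h1, h2⟩ := h
  exact ⟨u, h0, h1, fun k hk => (h2 k hk).trans_le hδ⟩

theorem HasChain.last (h : HasChain f δ (l + 1) p q) :
    ∃ r, HasChain f δ l p r ∧ dist (f r) q < δ := by
  obtain ⟨u, rfl, rfl, h2⟩ := h
  exact ⟨u l, ⟨u, rfl, rfl, fun k hk => h2 k (by omega)⟩, h2 l (by omega)⟩

theorem HasChain.first (h : HasChain f δ (l + 1) p q) :
    ∃ r, dist (f p) r < δ ∧ HasChain f δ l r q := by
  obtain ⟨u, rfl, rfl, h2⟩ := h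
  exact ⟨u 1, h2 0 (by omega), fun k => u (k + 1), rfl, rfl, fun k hk => h2 (k + 1) (by omega)⟩

/-- Moving the final point of a chain. -/
theorem HasChain.change_last {ε : ℝ} (h : HasChain f δ (l + 1) p q) (hqr : dist q r < ε) :
    HasChain f (δ + ε) (l + 1) p r := by
  have hε : 0 < ε := dist_nonneg.trans_lt hqr
  obtain ⟨s, hs, hsq⟩ := h.last
  refine (hs.mono (by linarith)).trans (HasChain.single ?_)
  linarith [dist_triangle (f s) q r]

/-- Moving the initial point of a chain. -/
theorem HasChain.change_first {ε : ℝ} (h : HasChain f δ (l + 1) p q)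
    (hpr : dist (f r) (f p) < ε) : HasChain f (δ + ε) (l + 1) r q := by
  have hε : 0 < ε := dist_nonneg.trans_lt hpr
  obtain ⟨s, hs, hsq⟩ := h.first
  rw [add_comm l 1]
  refine (HasChain.single ?_).trans (hsq.mono (by linarith))
  linarith [dist_triangle (f r) (f p) s]

theorem ChainReach.trans (h : ChainReach f p q) (h' : ChainReach f q r) : ChainReach f p r := by
  intro δ hδ
  obtain ⟨l, hl, c⟩ := h δ hδ
  obtain ⟨m, hm, c'⟩ := h' δ hδ
  exact ⟨l + m, by omega, c.trans c'⟩

theorem ChainReach.apply (f : X → X) (p : X) : ChainReach f p (f p) := fun _ hδ =>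
  ⟨1, one_pos, HasChain.single (by simpa using hδ)⟩

theorem ChainReach.apply_left (hf : Continuous f) (h : ChainReach f p p) :
    ChainReach f (f p) p := by
  intro δ hδ
  obtain ⟨η, hη, hη'⟩ := Metric.continuous_iff.1 hf (f p) (δ / 2) (by linarith)
  obtain ⟨l, hl, c⟩ := h (min η (δ / 2)) (by positivity)
  obtain ⟨l, rfl⟩ : ∃ k, l = k + 1 := ⟨l - 1, by omega⟩
  -- The loop is doubled so that a nonempty chain remains after removing its first jump.
  obtain ⟨r, hr, c'⟩ := HasChain.first (l := l + 1 + l) (c.trans c)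
  refine ⟨l + 1 + l, by omega, ?_⟩
  rw [show l + 1 + l = (l + l) + 1 by omega] at c' ⊢
  have h1 : dist (f (f p)) (f r) < δ / 2 := by
    rw [dist_comm]
    exact hη' r (by rw [dist_comm]; exact hr.trans_le (min_le_left _ _))
  exact (c'.change_first h1).mono (by linarith [min_le_right η (δ / 2)])

theorem ChainReach.symm_apply {f : X ≃ₜ X} (h : ChainReach f p p) :
    ChainReach f p (f.symm p) := by
  intro δ hδ
  obtain ⟨η, hη, hη'⟩ := Metric.continuous_iff.1 f.symm.continuous p (δ / 2) (by linarith)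
  obtain ⟨l, hl, c⟩ := h (min η (δ / 2)) (by positivity)
  obtain ⟨l, rfl⟩ : ∃ k, l = k + 1 := ⟨l - 1, by omega⟩
  obtain ⟨r, c', hr⟩ := HasChain.last (l := l + 1 + l) (c.trans c)
  refine ⟨l + 1 + l, by omega, ?_⟩
  rw [show l + 1 + l = (l + l) + 1 by omega] at c' ⊢
  have h1 : dist r (f.symm p) < δ / 2 := by
    have := hη' (f r) (hr.trans_le (min_le_left _ _))
    simpa using this
  exact (c'.change_last h1).mono (by linarith [min_le_right η (δ / 2)])

theorem mem_chainRecurrentSet_iff : p ∈ chainRecurrentSet f ↔ ChainReach f p p := by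
  constructor
  · intro h δ hδ
    obtain ⟨l, x, hl, hx, h0, h1⟩ := h δ hδ
    refine ⟨l, hl, fun k => x k, by simpa using h0, h1, fun k hk => ?_⟩
    simpa using hx k ⟨by omega, by omega⟩ ⟨by omega, by omega⟩
  · intro h δ hδ
    obtain ⟨l, hl, u, h0, h1, h2⟩ := h δ hδ
    refine ⟨l, fun k => u k.toNat, hl, ?_, by simpa using h0, by simpa using h1⟩
    rintro k ⟨hk, -⟩ ⟨-, hk'⟩
    have := h2 k.toNat (by omega)
    rwa [← show (k + 1).toNat = k.toNat + 1 by omega] at this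

theorem chainReach_of_mem_chainRecurrentClass (h : q ∈ chainRecurrentClass f p) :
    ChainReach f p q := by
  intro δ hδ
  obtain ⟨l, x, hl, hper, hx, ⟨i, rfl⟩, ⟨j, rfl⟩⟩ := h δ hδ
  -- Periodicity lets the visit to `q` be moved to a time after the visit to `p`.
  obtain ⟨t, ht⟩ : ∃ t : ℕ, i < j + t * l := by
    refine ⟨(i - j).toNat + 1, ?_⟩
    have h1 : (i - j).toNat + 1 ≤ ((i - j).toNat + 1) * l := Nat.le_mul_of_pos_right _ hl
    have h2 : i - j ≤ (i - j).toNat := Int.self_le_toNat _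
    zify at h1
    push_cast
    omega
  refine ⟨(j + t * l - i).toNat, by omega, fun k => x (i + k), by simp, ?_, fun k _ => ?_⟩
  · dsimp only
    rw [show i + ((j + t * l - i).toNat : ℤ) = j + t * l by omega]
    exact (hper.nat_mul t) j
  · have := hx (i + k) trivial trivial
    simpa [add_assoc] using this

theorem mem_chainRecurrentClass_symm (h : q ∈ chainRecurrentClass f p) :
    p ∈ chainRecurrentClass f q := by
  intro δ hδ
  obtain ⟨l, x, hl, hper, hx, hp, hq⟩ := h δ hδ
  exact ⟨l, x, hl, hper, hx, hq, hp⟩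

/-- Two loops at `p` of the same length, concatenated bi-infinitely: the block number `i` is `a`
and all others are `b`. -/
theorem isPseudoOrbit_blocks {a b : ℕ → X} {L : ℕ} (hL : 0 < L)
    (ha : ∀ k < L, dist (f (a k)) (a (k + 1)) < δ) (hb : ∀ k < L, dist (f (b k)) (b (k + 1)) < δ)
    (ha0 : a 0 = p) (hb0 : b 0 = p) (haL : a L = p) (hbL : b L = p) (i : ℤ) :
    IsPseudoOrbit f δ Set.univ
      (fun k : ℤ => if k / L = i then a (k % L).toNat else b (k % L).toNat) := by
  intro k _ _
  have hL' : (0 : ℤ) < L := by exact_mod_cast hL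
  have h0 := Int.emod_nonneg k hL'.ne'
  have h1 := Int.emod_lt_of_pos k hL'
  have h2 := Int.mul_ediv_add_emod k L
  by_cases hk : k % L + 1 < L
  · have h3 : (k + 1) / (L : ℤ) = k / L ∧ (k + 1) % (L : ℤ) = k % L + 1 :=
      (Int.ediv_emod_unique hL').2 ⟨by linarith, by omega, hk⟩
    have h4 : (k % L + 1).toNat = (k % L).toNat + 1 := by omega
    simp only [h3.1, h3.2, h4]
    split_ifs
    · exact ha _ (by omega)
    · exact hb _ (by omega)
  · have h3 : (k + 1) / (L : ℤ) = k / L + 1 ∧ (k + 1) % (L : ℤ) = 0 :=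
      (Int.ediv_emod_unique hL').2 ⟨by linarith [show k % (L : ℤ) + 1 = L by omega], le_rfl, hL'⟩
    have h4 : (k % L).toNat + 1 = L := by omega
    have e : ∀ c : Prop, [Decidable c] → (if c then a 0 else b 0) = p := by
      intro c _
      simp [ha0, hb0]
    simp only [h3.2, Int.toNat_zero, e]
    split_ifs
    · simpa [h4, haL] using ha (k % L).toNat (by omega)
    · simpa [h4, hbL] using hb (k % L).toNat (by omega)

theorem mem_chainRecurrentClass_self (h : p ∈ chainRecurrentSet f) :
    p ∈ chainRecurrentClass f p := by
  intro δ hδ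
  obtain ⟨l, hl, u, h0, h1, h2⟩ := mem_chainRecurrentSet_iff.1 h δ hδ
  have hp := isPseudoOrbit_blocks hl h2 h2 h0 h0 h1 h1 0
  simp only [ite_self] at hp
  exact ⟨l, _, hl, fun k => by simp, hp, ⟨0, by simpa using h0⟩, ⟨0, by simpa using h0⟩⟩

end Chains

/-! ### Equicontinuity and finiteness of classes -/

section Shadowing

variable {X : Type*} [MetricSpace X] {f : X ≃ₜ X} {n : ℕ} {c ε δ : ℝ}

theorem coe_pow_apply (f : X ≃ₜ X) (k : ℕ) (x : X) : (f ^ (k : ℤ)) x = f^[k] x := by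
  induction k generalizing x with
  | zero => rfl
  | succ k ih =>
    rw [Function.iterate_succ_apply, ← ih, Nat.cast_succ, zpow_add_one]
    rfl

/-- Two chains of the same length between points `a`, `b` and `p`, which can be closed up to loops,
start near each other. -/
theorem dist_lt_of_hasChain (hc : ∀ x, (localStableSet f c x).encard ≤ n) (hε : 2 * ε ≤ c)
    (hδ : ∀ x : ℤ → X, IsPseudoOrbit f δ Set.univ x → IsShadowed f ε x)
    {p a b : X} {s t k : ℕ} (hk : 0 < k) (hpa : HasChain f δ s p a) (hpb : HasChain f δ t p b)
    (hap : HasChain f δ k a p) (hbp : HasChain f δ k b p) : dist a b < 2 * ε := by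
  by_contra! hab
  -- `A` runs p→b→p→a→p and `B` runs p→a→p→b→p, so at the same index `A` is at `a` and `B` at `b`.
  obtain ⟨A, hA0, hAa, hAL, hA⟩ := ((hpb.trans hbp).trans hpa).concat hap
  obtain ⟨B, hB0, hBb, hBL, hB⟩ := ((hpa.trans hap).trans hpb).concat hbp
  have e : s + k + t = t + k + s := by omega
  rw [e] at hBb hBL hB
  have hlt : t + k + s < t + k + s + k := by omega
  generalize t + k + s + k = L at *
  generalize t + k + s = j at *
  have hL : 0 < L := by omega
  have hL' : (0 : ℤ) < L := by exact_mod_cast hL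
  choose y hy using fun i : ℤ => hδ _ (isPseudoOrbit_blocks hL hA hB hA0 hB0 hAL hBL i)
  have hne : ∀ i i' : ℤ, i ≠ i' → y i ≠ y i' := by
    intro i i' hi he
    have h1 := hy i (i * L + j)
    have h2 := hy i' (i * L + j)
    have h3 : (i * L + j) / (L : ℤ) = i ∧ (i * L + j) % (L : ℤ) = j :=
      (Int.ediv_emod_unique hL').2 ⟨by ring, by omega, by omega⟩
    rw [← he] at h2
    simp only [h3.1, h3.2, if_true, hi, if_false, Int.toNat_natCast, hAa, hBb] at h1 h2
    linarith [dist_triangle_left a b ((f ^ (i * L + j)) (y i))]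
  have hinj : Function.Injective (fun i : ℕ => y (-(i : ℤ) - 1)) := by
    intro i i' h
    by_contra h'
    exact hne _ _ (by omega) h
  -- The exceptional blocks all lie at negative times, so from time 0 on these points shadow the
  -- same sequence.
  have hsub : Set.range (fun i : ℕ => y (-(i : ℤ) - 1)) ⊆ localStableSet f c (y (-1)) := by
    rintro _ ⟨i, rfl⟩ k
    have h1 := hy (-(i : ℤ) - 1) k
    have h2 := hy (-1) k
    have h3 : 0 ≤ (k : ℤ) / L := Int.ediv_nonneg (by omega) (by omega)
    dsimp only at h1 h2
    rw [if_neg (by intro h; linarith), coe_pow_apply] at h1 h2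
    dsimp only
    linarith [dist_triangle_right (f^[k] (y (-(i : ℤ) - 1))) (f^[k] (y (-1)))
      (B ((k : ℤ) % L).toNat)]
  have hfin : (localStableSet f c (y (-1))).Finite :=
    Set.finite_of_encard_le_coe (hc _)
  exact Set.infinite_range_of_injective hinj (hfin.subset hsub)

/-- On a chain transitive set, the backward iterates of `f` are equicontinuous. -/
theorem exists_dist_lt_of_dist_iterate_lt (hexp : PositivelyNExpansive n f)
    (hshadow : ShadowingProperty f) {C : Set X} (hC : ∀ a ∈ C, ∀ b ∈ C, ChainReach f a b)
    (hmaps : ∀ a ∈ C, f a ∈ C) {η : ℝ} (hη : 0 < η) :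
    ∃ δ > 0, ∀ a ∈ C, ∀ b ∈ C, ∀ k : ℕ, dist (f^[k] a) (f^[k] b) < δ → dist a b < η := by
  obtain ⟨c, hc0, hc⟩ := hexp
  obtain ⟨δ, hδ0, hδ⟩ := hshadow (min c η / 2) (by positivity)
  refine ⟨min δ η, by positivity, fun a ha b hb k hk => ?_⟩
  rcases k with _ | k
  · exact hk.trans_le (min_le_right _ _)
  have hp : f^[k + 1] a ∈ C := (show Set.MapsTo f C C from hmaps).iterate (k + 1) ha
  obtain ⟨s, -, hs⟩ := hC _ hp a ha δ hδ0
  obtain ⟨t, -, ht⟩ := hC _ hp b hb δ hδ0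
  have hb' : HasChain f δ (k + 1) b (f^[k + 1] a) := by
    refine (HasChain.iterate hδ0 b k).trans (HasChain.single ?_)
    rw [← Function.iterate_succ_apply' f k b, dist_comm]
    exact hk.trans_le (min_le_left _ _)
  have := dist_lt_of_hasChain hc (by linarith [min_le_left c η]) hδ (Nat.succ_pos k) hs ht
    (HasChain.iterate hδ0 a (k + 1)) hb'
  linarith [min_le_right c η]

/-- On a fully invariant chain transitive set, the forward iterates of `f` are equicontinuous. -/
theorem exists_dist_iterate_lt_of_dist_lt [CompactSpace X] (hexp : PositivelyNExpansive n f)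
    (hshadow : ShadowingProperty f) {C : Set X} (hC : ∀ a ∈ C, ∀ b ∈ C, ChainReach f a b)
    (hmaps : ∀ a ∈ C, f a ∈ C) (hmaps' : ∀ a ∈ C, f.symm a ∈ C) {η : ℝ} (hη : 0 < η) :
    ∃ δ > 0, ∀ u ∈ C, ∀ v ∈ C, dist u v < δ → ∀ m : ℕ, dist (f^[m] u) (f^[m] v) < η := by
  obtain ⟨δ, hδ0, hδ⟩ := exists_dist_lt_of_dist_iterate_lt hexp hshadow hC hmaps
    (show 0 < η / 3 by positivity)
  refine ⟨δ, hδ0, fun u hu v hv huv m => ?_⟩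
  have hmaps1 : Set.MapsTo f C C := hmaps
  have hmaps2 : Set.MapsTo f.symm C C := hmaps'
  obtain ⟨z, φ, hφ, hz⟩ := CompactSpace.tendsto_subseq
    (fun k : ℕ => (f^[k] (f^[m] u), f^[k] (f^[m] v)))
  obtain ⟨N, hN⟩ := Metric.cauchySeq_iff.1 hz.cauchySeq δ hδ0
  -- Choosing index `N + m` makes the two times differ by `m + r` with `r ≥ 0`. Pulling back then
  -- puts `f^m x` near `f^{-r} x` for `x = u, v`.
  have hd := hN (N + m) (by omega) N le_rfl
  have hl : φ N + m ≤ φ (N + m) := by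
    have := hφ.add_le_nat m N
    rwa [add_comm, add_comm N m]
  obtain ⟨r, hr⟩ := Nat.exists_eq_add_of_le hl
  simp only [Function.comp, Prod.dist_eq, max_lt_iff, hr] at hd
  have hinv : Function.LeftInverse f f.symm := f.apply_symm_apply
  have key : ∀ x ∈ C, dist (f^[φ N + m + r] (f^[m] x)) (f^[φ N] (f^[m] x)) < δ →
      dist (f^[m] x) (f.symm^[r] x) < η / 3 := by
    intro x hx h
    refine hδ _ (hmaps1.iterate m hx) _ (hmaps2.iterate r hx) (φ N + m + r) ?_
    rwa [Function.iterate_add_apply f (φ N + m) r (f.symm^[r] x), hinv.iterate r x,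
      Function.iterate_add_apply f (φ N) m x]
  have h3 : dist (f.symm^[r] u) (f.symm^[r] v) < η / 3 := by
    refine hδ _ (hmaps2.iterate r hu) _ (hmaps2.iterate r hv) r ?_
    rwa [hinv.iterate r u, hinv.iterate r v]
  have h1 := key u hu hd.1
  have h2 := key v hv hd.2
  have h4 := dist_triangle4 (f^[m] u) (f.symm^[r] u) (f.symm^[r] v) (f^[m] v)
  rw [dist_comm (f.symm^[r] v)] at h4
  linarith

/-- Forward equicontinuity at scale `c` puts each `δ`-ball of the class inside a local stable set,
and finitely many balls suffice. The larger set `C` is used because its invariance under `f` and its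
inverse follows by composing chains. -/
theorem chainRecurrentClass_finite [CompactSpace X] (hexp : PositivelyNExpansive n f)
    (hshadow : ShadowingProperty f) (p : X) : (chainRecurrentClass f p).Finite := by
  have hto : ∀ a ∈ chainRecurrentClass f p, ChainReach f p a := fun a ha =>
    chainReach_of_mem_chainRecurrentClass ha
  have hfrom : ∀ a ∈ chainRecurrentClass f p, ChainReach f a p := fun a ha =>
    chainReach_of_mem_chainRecurrentClass (mem_chainRecurrentClass_symm ha)
  set C : Set X := {q | ChainReach f p q ∧ ChainReach f q p}
  have hsub : chainRecurrentClass f p ⊆ C := fun a ha => ⟨hto a ha, hfrom a ha⟩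
  refine Set.Finite.subset ?_ hsub
  have hC : ∀ a ∈ C, ∀ b ∈ C, ChainReach f a b := fun a ha b hb => ha.2.trans hb.1
  have hmaps : ∀ a ∈ C, f a ∈ C := fun a ha =>
    ⟨ha.1.trans (ChainReach.apply f a),
      (ChainReach.apply_left f.continuous (hC a ha a ha)).trans ha.2⟩
  have hmaps' : ∀ a ∈ C, f.symm a ∈ C := fun a ha => by
    refine ⟨ha.1.trans (ChainReach.symm_apply (hC a ha a ha)), ChainReach.trans ?_ ha.2⟩
    simpa using ChainReach.apply f (f.symm a)
  obtain ⟨c, hc0, hc⟩ := id hexp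
  obtain ⟨δ, hδ0, hδ⟩ := exists_dist_iterate_lt_of_dist_lt hexp hshadow hC hmaps hmaps' hc0
  obtain ⟨t, htC, ht, hcov⟩ := Metric.finite_approx_of_totallyBounded
    ((isCompact_univ.totallyBounded).subset (Set.subset_univ C)) δ hδ0
  refine (ht.biUnion fun y _ => Set.finite_of_encard_le_coe (hc y)).subset fun q hq => ?_
  obtain ⟨y, hy, hqy⟩ := Set.mem_iUnion₂.1 (hcov hq)
  exact Set.mem_iUnion₂.2 ⟨y, hy, fun k => (hδ q hq y (htC hy) hqy k).le⟩

end Shadowing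

/-! ### Limit sets and eventual periodicity -/

section LimitSets

variable {X : Type*} [MetricSpace X] {f : X → X}

theorem mem_chainRecurrentSet_of_mapClusterPt (hf : Continuous f) {x z : X}
    (h : MapClusterPt z atTop (fun k : ℕ => f^[k] x)) : z ∈ chainRecurrentSet f := by
  rw [mem_chainRecurrentSet_iff]
  intro ε hε
  obtain ⟨η, hη, hη'⟩ := Metric.continuous_iff.1 hf z ε hε
  obtain ⟨i, -, hi⟩ := frequently_atTop.1 (h.frequently (Metric.ball_mem_nhds z hη)) 0
  -- The first jump lands at time `i + 1`, so the closing jump lands at time `i + 2` or later.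
  obtain ⟨j, hij, hj⟩ := frequently_atTop.1 (h.frequently (Metric.ball_mem_nhds z hε)) (i + 2)
  obtain ⟨m, rfl⟩ := Nat.exists_eq_add_of_le hij
  have h1 : HasChain f ε 1 z (f^[i + 1] x) := HasChain.single <| by
    rw [Function.iterate_succ_apply', dist_comm]
    exact hη' _ hi
  have h2 := HasChain.iterate (f := f) hε (f^[i + 1] x) m
  have h3 : HasChain f ε 1 (f^[m] (f^[i + 1] x)) z := HasChain.single <| by
    rw [← Function.iterate_succ_apply' f, ← Function.iterate_add_apply,
      show m.succ + (i + 1) = i + 2 + m by omega]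
    exact hj
  exact ⟨1 + m + 1, by omega, (h1.trans h2).trans h3⟩

theorem mem_chainRecurrentSet_of_iterate_eq {x : X} {m : ℕ} (hm : 0 < m) (h : f^[m] x = x) :
    x ∈ chainRecurrentSet f := by
  rw [mem_chainRecurrentSet_iff]
  intro ε hε
  have := HasChain.iterate (f := f) hε x m
  rw [h] at this
  exact ⟨m, hm, this⟩

theorem apply_mem_chainRecurrentSet (hf : Continuous f) {x : X}
    (h : x ∈ chainRecurrentSet f) : f x ∈ chainRecurrentSet f := by
  rw [mem_chainRecurrentSet_iff] at h ⊢
  exact (ChainReach.apply_left hf h).trans (ChainReach.apply f x)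

theorem eventually_exists_dist_lt [CompactSpace X] (hf : Continuous f) (x : X) {r : ℝ}
    (hr : 0 < r) : ∀ᶠ k : ℕ in atTop, ∃ p ∈ chainRecurrentSet f, dist (f^[k] x) p < r := by
  by_contra hcon
  rw [not_eventually] at hcon
  obtain ⟨φ, hφ, hφ'⟩ := extraction_of_frequently_atTop hcon
  obtain ⟨z, ψ, hψ, hz⟩ := CompactSpace.tendsto_subseq (fun k : ℕ => f^[φ k] x)
  have hzC : z ∈ chainRecurrentSet f := by
    refine mem_chainRecurrentSet_of_mapClusterPt hf (x := x) ?_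
    exact MapClusterPt.of_comp (φ := φ ∘ ψ) (hφ.comp hψ).tendsto_atTop hz.mapClusterPt
  obtain ⟨k, hk⟩ := (hz.eventually (Metric.ball_mem_nhds z hr)).exists
  exact hφ' (ψ k) ⟨z, hzC, hk⟩

/-- If the chain recurrent set is finite, every orbit eventually follows a chain recurrent orbit
closely. -/
theorem eventually_mem_localStableSet [CompactSpace X] (hf : Continuous f)
    (hfin : (chainRecurrentSet f).Finite) (x : X) {c : ℝ} (hc : 0 < c) :
    ∀ᶠ k : ℕ in atTop, ∃ p ∈ chainRecurrentSet f, f^[k] x ∈ localStableSet f c p := by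
  obtain ⟨s, hs0, hs⟩ : ∃ s > 0, ∀ p ∈ chainRecurrentSet f, ∀ q ∈ chainRecurrentSet f,
      dist p q < s → p = q := by
    obtain ⟨s, hs, h⟩ := ENNReal.lt_iff_exists_nnreal_btwn.1 hfin.einfsep_pos
    refine ⟨s, by exact_mod_cast hs, fun p hp q hq hpq => ?_⟩
    by_contra hne
    refine (h.trans_le (Set.einfsep_le_edist_of_mem hp hq hne)).not_gt ?_
    rw [edist_nndist]
    exact_mod_cast hpq
  obtain ⟨r, hr0, hr⟩ := Metric.uniformContinuous_iff.1
    (CompactSpace.uniformContinuous_of_continuous hf) (s / 2) (by positivity)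
  obtain ⟨K, hK⟩ := eventually_atTop.1 (eventually_exists_dist_lt hf x
    (show 0 < min c (min r (s / 2)) by positivity))
  refine eventually_atTop.2 ⟨K, fun k hk => ?_⟩
  obtain ⟨p, hp, hpk⟩ := hK k hk
  refine ⟨p, hp, fun j => ?_⟩
  suffices h : f^[j] p ∈ chainRecurrentSet f ∧
      dist (f^[j] (f^[k] x)) (f^[j] p) < min c (min r (s / 2)) from
    (h.2.trans_le (min_le_left _ _)).le
  induction j with
  | zero => exact ⟨hp, hpk⟩
  | succ j ih =>
    obtain ⟨h1, h2⟩ := ih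
    have h3 : f (f^[j] p) ∈ chainRecurrentSet f := apply_mem_chainRecurrentSet hf h1
    obtain ⟨q, hq, hqk⟩ := hK (j + 1 + k) (by omega)
    rw [Function.iterate_add_apply] at hqk
    rw [Function.iterate_succ_apply'] at hqk
    rw [Function.iterate_succ_apply' f j p, Function.iterate_succ_apply' f j (f^[k] x)]
    have h4 := hr (h2.trans_le ((min_le_right _ _).trans (min_le_left _ _)))
    have h5 := hqk.trans_le ((min_le_right _ _).trans (min_le_right _ _))
    -- Both points are within `s / 2` of the orbit, and distinct chain recurrent points are at least
    -- `s` apart.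
    have h6 : f (f^[j] p) = q := hs _ h3 _ hq (by
      linarith [dist_triangle_left (f (f^[j] p)) q (f (f^[j] (f^[k] x)))])
    rw [h6]
    exact ⟨hq, hqk⟩

theorem mem_chainRecurrentSet_of_finite [CompactSpace X] {n : ℕ} (hf : Continuous f)
    (hinj : Function.Injective f) (hexp : PositivelyNExpansive n f)
    (hfin : (chainRecurrentSet f).Finite) (x : X) : x ∈ chainRecurrentSet f := by
  obtain ⟨c, hc0, hc⟩ := hexp
  obtain ⟨K, hK⟩ := eventually_atTop.1 (eventually_mem_localStableSet hf hfin x hc0)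
  have hfin' : (⋃ p ∈ chainRecurrentSet f, localStableSet f c p).Finite :=
    hfin.biUnion fun p _ => Set.finite_of_encard_le_coe (hc p)
  obtain ⟨i, hi, j, -, hij, he⟩ := (Set.Ici_infinite K).exists_lt_map_eq_of_mapsTo
    (f := fun k : ℕ => f^[k] x) (fun k hk => Set.mem_iUnion₂.2 <| by simpa using hK k hk) hfin'
  obtain ⟨m, rfl⟩ := Nat.exists_eq_add_of_lt hij
  refine mem_chainRecurrentSet_of_iterate_eq (m := m + 1) (by omega) (hinj.iterate i ?_)
  rw [← Function.iterate_add_apply]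
  exact he.symm

end LimitSets

end NExpansive

theorem theorem2p4 {X : Type*} [MetricSpace X] [CompactSpace X] (f : X ≃ₜ X) (n : ℕ)
    (hexp : NExpansive.PositivelyNExpansive n f)
    (hshadow : NExpansive.ShadowingProperty f)
    (hclasses : (NExpansive.chainRecurrentClasses f).Finite) :
    Finite X := by
  have hfin : (NExpansive.chainRecurrentSet f).Finite := by
    refine (hclasses.sUnion ?_).subset fun p hp =>
      ⟨_, ⟨p, hp, rfl⟩, NExpansive.mem_chainRecurrentClass_self hp⟩
    rintro _ ⟨p, -, rfl⟩
    exact NExpansive.chainRecurrentClass_finite hexp hshadow p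
  refine Set.finite_univ_iff.1 (hfin.subset fun x _ => ?_)
  exact NExpansive.mem_chainRecurrentSet_of_finite f.continuous f.injective hexp hfin x
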